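/- Let $N\ge 2$ and $\alpha\in(-1,0)$. Let $\mathbb S^{N-1}_+=\{\zeta\in\mathbb R^N:\ |\zeta|=1,\ \zeta_N>0\}$ be the open half-sphere, write $\zeta_N=\cos\theta_1$ with $\theta_1\in[0,\pi/2)$, let $\sigma$ be the surface measure and put $d\sigma_\alpha=\zeta_N^{\alpha}\,d\sigma$. Let $W^{1,2}(\mathbb S^{N-1}_+;d\sigma_\alpha)$ be the closure of the functions $u\in C^\infty(\mathbb S^{N-1}_+)$ with finite norm under the norm $\big(\int_{\mathbb S^{N-1}_+} u^2\,d\sigma_\alpha+\int_{\mathbb S^{N-1}_+}|\nabla_{\mathbb S}u|^2\,d\sigma_\alpha\big)^{1/2}$, where $\nabla_{\mathbb S}$ is the gradient on the sphere. Consider the weighted Neumann eigenvalue problem $$-\Delta^\alpha_{\mathbb S^{N-1}}u=\mu\cos^\alpha\theta_1\,u\ \text{ on }\mathbb S^{N-1}_+,\qquad \int_{\mathbb S^{N-1}_+}u\,d\sigma_\alpha=0,$$ where $$\Delta^\alpha_{\mathbb S^{N-1}}u=\mathrm{div}_{\mathbb S}(\cos^\alpha\theta_1\nabla_{\mathbb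 S}u)=\frac{1}{\sin^{N-2}\theta_1}\frac{\partial}{\partial\theta_1}\Big(\sin^{N-2}\theta_1\cos^\alpha\theta_1\frac{\partial u}{\partial\theta_1}\Big)+\frac{\cos^\alpha\theta_1}{\sin^2\theta_1}\Delta_{\mathbb S^{N-2}}u,$$ understood in the weak sense: a real number $\mu$ is an eigenvalue if there is $u\in W^{1,2}(\mathbb S^{N-1}_+;d\sigma_\alpha)$, $u\neq0$, with $\int u\,d\sigma_\alpha=0$ and $\int\nabla_{\mathbb S}u\cdot\nabla_{\mathbb S}\varphi\,d\sigma_\alpha=\mu\int u\varphi\,d\sigma_\alpha$ for all $\varphi\in W^{1,2}(\mathbb S^{N-1}_+;d\sigma_\alpha)$ (all integrals over $\mathbb S^{N-1}_+$). Then the smallest eigenvalue of this problem, that is, the first nontrivial Neumann eigenvalue $\mu_1^\alpha(\mathbb S^{N-1}_+)$, exists and $$\mu_1^\alpha(\mathbb S^{N-1}_+)=N+\alpha-1 .$$ Moreover, $$N+\alpha-1=\min\left\{\frac{\int_{\mathbb S^{N-1}_+}|\nabla_{\mathbb S}u|^2\,d\sigma_\alpha}{\int_{\mathbb S^{N-1}_+}u^2\,d\sigma_\alpha}:\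 u\in W^{1,2}(\mathbb S^{N-1}_+;d\sigma_\alpha)\setminus\{0\},\ \int_{\mathbb S^{N-1}_+}u\,d\sigma_\alpha=0\right\},$$ and $c=N+\alpha-1$ is the largest constant for which the weighted Wirtinger inequality $$c\int_{\mathbb S^{N-1}_+}\Big(u-\frac{1}{\sigma_\alpha(\mathbb S^{N-1}_+)}\int_{\mathbb S^{N-1}_+}u\,d\sigma_\alpha\Big)^2d\sigma_\alpha\le\int_{\mathbb S^{N-1}_+}|\nabla_{\mathbb S}u|^2\,d\sigma_\alpha$$ holds for all $u\in W^{1,2}(\mathbb S^{N-1}_+;d\sigma_\alpha)$. -/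

import Mathlib

open MeasureTheory
open scoped ENNReal ContDiff

noncomputable section

namespace HalfSphere

/-- Euclidean space `ℝ^N` with `N = n + 1`; the coordinate `x_N` is `x (Fin.last n)`. -/
abbrev E (n : ℕ) : Type := EuclideanSpace ℝ (Fin (n + 1))

/-- The unit sphere `S^{N-1}` of `ℝ^N`, `N = n + 1`. -/
abbrev S (n : ℕ) : Type := Metric.sphere (0 : E n) 1

/-- The open half-space `ℝ^N_+ = {x : x_N > 0}`. -/
def halfSpace (n : ℕ) : Set (E n) := {x | 0 < x (Fin.last n)}

/-- The open half-sphere `S^{N-1}_+ = S^{N-1} ∩ ℝ^N_+`. -/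
def upper (n : ℕ) : Set (S n) := {ζ | (ζ : E n) ∈ halfSpace n}

/-- The weighted measure `dσ_α = ζ_N^α dσ` on the half-sphere, where `σ` is the surface measure of
the unit sphere. Note `ζ_N = cos θ_1`. -/
def sigma (n : ℕ) (α : ℝ) : Measure (S n) :=
  ((volume : Measure (E n)).toSphere.restrict (upper n)).withDensity
    (fun ζ => ENNReal.ofReal ((ζ : E n) (Fin.last n) ^ α))

/-- The tangential gradient `∇_S F` on the sphere of (the restriction of) a function `F`:
the orthogonal projection of `∇F(ζ)` onto the tangent space `ζ^⊥`. At points near which `F` is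
smooth it depends only on the restriction of `F` to the sphere. -/
def sphGrad {n : ℕ} (F : E n → ℝ) (ζ : S n) : E n :=
  gradient F (ζ : E n) - inner ℝ (ζ : E n) (gradient F (ζ : E n)) • (ζ : E n)

/-- The weighted Sobolev space `W^{1,2}(S^{N-1}_+; dσ_α)`: the closure, in the norm
`(‖u‖² + ‖∇_S u‖²)^{1/2}` with both norms taken in `L²(dσ_α)`, of the smooth functions on the open
half-sphere for which this norm is finite. An element is recorded as the pair `(u, ∇_S u)`.
A function on the open half-sphere is smooth iff it is the restriction of a function `F` which is
smooth on the open half-space (for instance, of its extension that is constant along rays). -/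
def W12 (n : ℕ) (α : ℝ) : Set (Lp ℝ 2 (sigma n α) × Lp (E n) 2 (sigma n α)) :=
  closure {p | ∃ F : E n → ℝ, ContDiffOn ℝ ∞ F (halfSpace n) ∧
    p.1 =ᵐ[sigma n α] (fun ζ => F (ζ : E n)) ∧ p.2 =ᵐ[sigma n α] sphGrad F}

/-- `μ` is an eigenvalue of the weighted Neumann problem
`-Δ^α u = μ cos^α θ_1 u` on `S^{N-1}_+`, `∫ u dσ_α = 0`. Here
`Δ^α u = div_S (cos^α θ_1 ∇_S u)` is the operator which in spherical coordinates reads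
`sin^{2-N} θ_1 ∂_1 (sin^{N-2} θ_1 cos^α θ_1 ∂_1 u) + cos^α θ_1 sin^{-2} θ_1 Δ_{S^{N-2}} u`,
and the Neumann problem is understood, as usual, in the weak sense:
`∫ ∇_S u · ∇_S φ dσ_α = μ ∫ u φ dσ_α` for all `φ` in `W^{1,2}`. -/
def IsEigenvalue (n : ℕ) (α μ : ℝ) : Prop :=
  ∃ u ∈ W12 n α, u.1 ≠ 0 ∧ ∫ ζ, u.1 ζ ∂(sigma n α) = 0 ∧
    ∀ φ ∈ W12 n α,
      ∫ ζ, inner ℝ (u.2 ζ) (φ.2 ζ) ∂(sigma n α) = μ * ∫ ζ, u.1 ζ * φ.1 ζ ∂(sigma n α)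

/-- The values of the Rayleigh quotient `∫ |∇_S u|² dσ_α / ∫ u² dσ_α` over the nonzero
`u` in `W^{1,2}` with `∫ u dσ_α = 0`. -/
def rayleighValues (n : ℕ) (α : ℝ) : Set ℝ :=
  {r | ∃ u ∈ W12 n α, u.1 ≠ 0 ∧ ∫ ζ, u.1 ζ ∂(sigma n α) = 0 ∧
    r = (∫ ζ, ‖u.2 ζ‖ ^ 2 ∂(sigma n α)) / ∫ ζ, (u.1 ζ) ^ 2 ∂(sigma n α)}

/-- The constants `c` for which the weighted Wirtinger inequality
`c ∫ (u - ū)² dσ_α ≤ ∫ |∇_S u|² dσ_α` holds for all `u` in `W^{1,2}`, where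
`ū` is the `σ_α`-mean of `u` over the half-sphere. -/
def wirtingerConstants (n : ℕ) (α : ℝ) : Set ℝ :=
  {c | ∀ u ∈ W12 n α,
    c * ∫ ζ, (u.1 ζ - ⨍ η, u.1 η ∂(sigma n α)) ^ 2 ∂(sigma n α)
      ≤ ∫ ζ, ‖u.2 ζ‖ ^ 2 ∂(sigma n α)}

end HalfSphere

end

/-!
The function `ζ_j`, `j < N`, satisfies the weak Neumann problem with eigenvalue `N + α - 1`, so all
that has to be shown is the Wirtinger inequality with this constant. The proof diagonalizes the
weighted Laplacian on polynomials.

Polynomials in the tangential coordinates `ζ_1, …, ζ_{N-1}` are mapped to such polynomials by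
`-ζ_N^{-α} Δ^α`, here called `polyOp`, and by Euler's identity `polyOp` acts on those of degree `k`
as `k (k + N - 2 + α)` modulo lower degree. Being symmetric in `L²(σ_α)`, it is therefore at least
`N + α - 1` on the polynomials orthogonal to constants (`le_inner_of_triangular`). These polynomials
are dense in `L²(σ_α)` (`denseRange_polyLp`), because on the upper half-sphere `ζ_N` is a function
of the other coordinates. It is not necessary to know that they are dense in `W^{1,2}`: since
`∫ ∇p · ∇u dσ_α = ∫ (polyOp p) u dσ_α` for every `u` in `W^{1,2}` (`inner_gradLp`), projecting `u`
onto the polynomials of bounded degree does not increase its energy, and the inequality passes to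
the limit (`le_norm_sq_of_triangular`).

The integration by parts comes from the divergence theorem on the sphere for the conformal fields
`v - ⟪v, ζ⟫ ζ` (`integral_inner_sphGrad`), itself integration by parts in `ℝ^N` read in polar
coordinates. For `v` parallel to the equator a cut-off near the equator brings in the weight without
boundary term (`integral_inner_sphGrad_sigma`); this, and the finiteness of `σ_α`, use `α > -1`.
-/

noncomputable section

namespace HalfSphere

/-! ### Polar coordinates and the divergence theorem on the sphere -/

section Polar

variable {V : Type*} [NormedAddCommGroup V] [NormedSpace ℝ V] [MeasurableSpace V] [BorelSpace V]
  [FiniteDimensional ℝ V] [Nontrivial V] (μ : Measure V) [μ.IsAddHaarMeasure]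

/-- Polar coordinates for the product of a radial and a positively `0`-homogeneous function. -/
lemma integral_norm_mul_normalize (f : ℝ → ℝ) (H : V → ℝ) :
    ∫ x, f ‖x‖ * H (‖x‖⁻¹ • x) ∂μ =
      (∫ ζ : Metric.sphere (0 : V) 1, H ζ ∂μ.toSphere) *
        ∫ r, f (r : ℝ) ∂(Measure.volumeIoiPow (Module.finrank ℝ V - 1)) := by
  calc
    _ = ∫ x : ({(0)}ᶜ : Set V), f ‖x.1‖ * H (‖x.1‖⁻¹ • x.1) ∂(μ.comap (↑)) := by
      rw [integral_subtype_comap (measurableSet_singleton _).compl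
        fun x ↦ f (‖x‖) * H (‖x‖⁻¹ • x), restrict_compl_singleton]
    _ = ∫ x, H x.1 * f x.2 ∂μ.toSphere.prod
          (.volumeIoiPow (Module.finrank ℝ V - 1)) := by
      rw [← μ.measurePreserving_homeomorphUnitSphereProd.integral_comp
        (Homeomorph.measurableEmbedding _)]
      refine integral_congr_ae (.of_forall fun x => ?_)
      simp [mul_comm]
    _ = _ := integral_prod_mul (fun ζ : Metric.sphere (0 : V) 1 => H ζ)
          (fun r : Set.Ioi (0 : ℝ) => f r)

lemma lintegral_norm_mul_normalize {f : ℝ → ℝ≥0∞} (hf : Measurable f) {H : V → ℝ≥0∞}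
    (hH : Measurable H) :
    ∫⁻ x, f ‖x‖ * H (‖x‖⁻¹ • x) ∂μ =
      (∫⁻ ζ : Metric.sphere (0 : V) 1, H ζ ∂μ.toSphere) *
        ∫⁻ r, f (r : ℝ) ∂(Measure.volumeIoiPow (Module.finrank ℝ V - 1)) := by
  calc
    _ = ∫⁻ x : ({(0)}ᶜ : Set V), f ‖x.1‖ * H (‖x.1‖⁻¹ • x.1) ∂(μ.comap (↑)) := by
      rw [lintegral_subtype_comap (measurableSet_singleton _).compl
        fun x ↦ f (‖x‖) * H (‖x‖⁻¹ • x), restrict_compl_singleton]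
    _ = ∫⁻ x, H x.1 * f x.2 ∂μ.toSphere.prod
          (.volumeIoiPow (Module.finrank ℝ V - 1)) := by
      rw [← μ.measurePreserving_homeomorphUnitSphereProd.lintegral_comp_emb
        (Homeomorph.measurableEmbedding _)]
      refine lintegral_congr fun x => ?_
      simp [mul_comm]
    _ = _ := lintegral_prod_mul (f := fun ζ : Metric.sphere (0 : V) 1 => H ζ)
          (g := fun r : Set.Ioi (0 : ℝ) => f r) (hH.comp measurable_subtype_coe).aemeasurable
          (hf.comp measurable_subtype_coe).aemeasurable

end Polar

/-- The quadratic vector field `x ↦ |x|² v - ⟪v, x⟫ x` is tangent to all spheres centred at the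
origin and has divergence `-n ⟪v, x⟫` in `ℝ^(n+1)`; this is integration by parts along it. -/
lemma integral_fderiv_tangential {n : ℕ} (v : E n) {h : E n → ℝ} (hh : ContDiff ℝ 1 h)
    (hc : HasCompactSupport h) :
    ∫ x, fderiv ℝ h x (‖x‖ ^ 2 • v - inner ℝ v x • x) = n * ∫ x, inner ℝ v x * h x := by
  set b : Fin (n + 1) → E n → ℝ := fun i x => ‖x‖ ^ 2 * v i - inner ℝ v x * x i with hb
  set e : Fin (n + 1) → E n := fun i => EuclideanSpace.single i 1 with he
  have hbd : ∀ i, ContDiff ℝ 1 (b i) := fun i => by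
    have : ContDiff ℝ 1 fun x : E n => x i := contDiff_piLp_apply 2
    have h2 : ContDiff ℝ 1 fun x : E n => inner ℝ v x := contDiff_const.inner ℝ contDiff_id
    exact ((contDiff_norm_sq ℝ).mul contDiff_const).sub (h2.mul this)
  have hfb : ∀ i x, fderiv ℝ (b i) x (e i) = v i * x i - inner ℝ v x := fun i x => by
    have h1 : HasFDerivAt (fun x : E n => x i) (EuclideanSpace.proj i : E n →L[ℝ] ℝ) x :=
      (EuclideanSpace.proj i : E n →L[ℝ] ℝ).hasFDerivAt
    have h2 : HasFDerivAt (fun x : E n => inner ℝ v x) (innerSL ℝ v) x :=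
      (innerSL ℝ v).hasFDerivAt
    have h3 := (((hasStrictFDerivAt_norm_sq x).hasFDerivAt).mul_const (v i)).sub (h2.mul h1)
    have h4 := h3.fderiv
    have h5 : fderiv ℝ (b i) x = _ := h4
    rw [h5]
    simp [he, EuclideanSpace.inner_single_right]
    ring
  have hcf : ∀ w, HasCompactSupport fun x => fderiv ℝ h x w := fun w => by
    exact hc.fderiv_apply (𝕜 := ℝ) w
  have hcont : ∀ w, Continuous fun x => fderiv ℝ h x w := fun w =>
    (hh.continuous_fderiv (by norm_num)).clm_apply continuous_const
  have hcontb : ∀ i w, Continuous fun x => fderiv ℝ (b i) x w := fun i w =>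
    ((hbd i).continuous_fderiv (by norm_num)).clm_apply continuous_const
  have hi1 : ∀ i, Integrable fun x => b i x * fderiv ℝ h x (e i) := fun i =>
    ((hbd i).continuous.mul (hcont _)).integrable_of_hasCompactSupport (hcf _).mul_left
  have hi2 : ∀ i, Integrable fun x => fderiv ℝ (b i) x (e i) * h x := fun i =>
    ((hcontb i _).mul hh.continuous).integrable_of_hasCompactSupport hc.mul_left
  have hi3 : ∀ i, Integrable fun x => b i x * h x := fun i =>
    ((hbd i).continuous.mul hh.continuous).integrable_of_hasCompactSupport hc.mul_left
  have hibp : ∀ i, ∫ x, b i x * fderiv ℝ h x (e i) = -∫ x, fderiv ℝ (b i) x (e i) * h x :=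
    fun i => integral_mul_fderiv_eq_neg_fderiv_mul_of_integrable (hi2 i) (hi1 i) (hi3 i)
      (fun x _ => ((hbd i).differentiable (by norm_num)) x)
      (fun x _ => (hh.differentiable (by norm_num)) x)
  have hdec : ∀ w : E n, w = ∑ i, w i • e i := fun w => by
    ext j
    simp [he, Finset.sum_apply, Pi.single_apply]
  have hL : ∀ x, fderiv ℝ h x (‖x‖ ^ 2 • v - inner ℝ v x • x)
      = ∑ i, b i x * fderiv ℝ h x (e i) := fun x => by
    conv_lhs => rw [hdec (‖x‖ ^ 2 • v - inner ℝ v x • x), map_sum]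
    simp [hb]
  have hR : ∀ x, ∑ i, fderiv ℝ (b i) x (e i) * h x = -(n * (inner ℝ v x * h x)) := fun x => by
    have : inner ℝ v x = ∑ i, v i * x i := by
      simp [PiLp.inner_apply, mul_comm]
    simp_rw [hfb, sub_mul]
    rw [Finset.sum_sub_distrib, ← Finset.sum_mul, ← this]
    simp
    ring
  simp_rw [hL]
  rw [integral_finsetSum _ fun i _ => hi1 i]
  simp_rw [hibp]
  rw [Finset.sum_neg_distrib, ← integral_finsetSum _ fun i _ => hi2 i]
  simp_rw [hR]
  rw [integral_neg, neg_neg, integral_const_mul]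

/-- No smoothness is needed: `gradient` and `fderiv` take the same junk value. -/
lemma inner_sphGrad {n : ℕ} (v : E n) (F : E n → ℝ) (ζ : S n) :
    inner ℝ v (sphGrad F ζ) = fderiv ℝ F ζ (v - inner ℝ v (ζ : E n) • (ζ : E n)) := by
  have h : ∀ w, fderiv ℝ F ζ w = inner ℝ (gradient F (ζ : E n)) w := fun w => by
    simp [gradient]
  rw [h, sphGrad, inner_sub_right, inner_sub_right, inner_smul_right, inner_smul_right,
    real_inner_comm _ v, real_inner_comm _ (ζ : E n)]
  ring

/-- The divergence theorem on the unit sphere of `ℝ^(n+1)` for the tangential field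
`G(ζ) (v - ⟪v, ζ⟫ ζ)`. It follows from `integral_fderiv_tangential` applied to
`ψ(|x|) G(x / |x|)` with a bump function `ψ`, in polar coordinates. -/
theorem integral_inner_sphGrad {n : ℕ} (v : E n) {G : E n → ℝ} (hG : ContDiff ℝ 1 G) :
    ∫ ζ : S n, inner ℝ v (sphGrad G ζ) ∂(volume : Measure (E n)).toSphere =
      n * ∫ ζ : S n, inner ℝ v (ζ : E n) * G ζ ∂(volume : Measure (E n)).toSphere := by
  let ψ : ContDiffBump (2 : ℝ) := ⟨1 / 2, 1, by norm_num, by norm_num⟩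
  set h : E n → ℝ := fun x => ψ ‖x‖ * G (‖x‖⁻¹ • x) with hh
  have hψ0 : ∀ r : ℝ, r ≤ 1 ∨ 3 ≤ r → ψ r = 0 := fun r hr => ψ.zero_of_le_dist (by
    simp only [ψ, Real.dist_eq]
    rcases hr with hr | hr
    · rw [abs_sub_comm]; exact le_trans (by linarith) (le_abs_self _)
    · exact le_trans (by linarith) (le_abs_self _))
  have hcs : HasCompactSupport h := by
    refine HasCompactSupport.intro (isCompact_closedBall (0 : E n) 3) fun x hx => ?_
    have : 3 < ‖x‖ := by simpa using hx
    simp [hh, hψ0 _ (Or.inr this.le)]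
  have hsm : ContDiff ℝ 1 h := by
    rw [contDiff_iff_contDiffAt]
    intro x
    by_cases hx : x = 0
    · refine contDiffAt_const (c := (0 : ℝ)) |>.congr_of_eventuallyEq ?_
      filter_upwards [Metric.ball_mem_nhds x one_pos] with y hy
      have : ‖y‖ < 1 := by simpa [hx] using hy
      simp [hh, hψ0 _ (Or.inl this.le)]
    · have h1 : ContDiffAt ℝ 1 (fun x : E n => ‖x‖) x := contDiffAt_norm ℝ hx
      have h2 : ContDiffAt ℝ 1 (fun x : E n => ‖x‖⁻¹ • x) x :=
        (h1.inv (by simpa using hx)).smul contDiffAt_id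
      exact (ψ.contDiffAt.comp x h1).mul (hG.contDiffAt.comp x h2)
  have hder : ∀ x : E n, fderiv ℝ h x (‖x‖ ^ 2 • v - inner ℝ v x • x) =
      (ψ ‖x‖ * ‖x‖) * fderiv ℝ G (‖x‖⁻¹ • x)
        (v - inner ℝ v (‖x‖⁻¹ • x) • (‖x‖⁻¹ • x)) := fun x => by
    by_cases hx : x = 0
    · simp [hx]
    have hx' : ‖x‖ ≠ 0 := by simpa using hx
    have h1 : HasFDerivAt (fun x : E n => ‖x‖) (fderiv ℝ (fun x : E n => ‖x‖) x) x :=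
      ((contDiffAt_norm ℝ hx).differentiableAt (n := 1) (by norm_num)).hasFDerivAt
    set B : E n := ‖x‖ ^ 2 • v - inner ℝ v x • x with hB
    have hxB : inner ℝ x B = 0 := by
      rw [hB, inner_sub_right, inner_smul_right, inner_smul_right, real_inner_self_eq_norm_sq,
        real_inner_comm]
      ring
    -- The field is tangent to spheres, so the radial factor `ψ(|x|)` is not differentiated.
    have h1B : fderiv ℝ (fun x : E n => ‖x‖) x B = 0 := by
      have h2 := (hasStrictFDerivAt_norm_sq x).hasFDerivAt.unique (h1.pow 2)
      have h3 := congrArg (fun L => L B) h2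
      simp [hxB] at h3
      tauto
    have h2 : HasFDerivAt (fun x : E n => ‖x‖⁻¹ • x) _ x :=
      ((hasDerivAt_inv hx').comp_hasFDerivAt x h1).smul (hasFDerivAt_id x)
    have hGx : HasFDerivAt G (fderiv ℝ G (‖x‖⁻¹ • x)) (‖x‖⁻¹ • x) :=
      ((hG.differentiable (by norm_num)) _).hasFDerivAt
    have h3 := ((ψ.contDiff.differentiable (n := 1) (by norm_num) ‖x‖).hasDerivAt.comp_hasFDerivAt
      x h1).mul (HasFDerivAt.comp (f := fun x : E n => ‖x‖⁻¹ • x) x hGx h2)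
    have h4 : fderiv ℝ h x = _ := h3.fderiv
    have h5 : ‖x‖⁻¹ • B = ‖x‖ • (v - inner ℝ v (‖x‖⁻¹ • x) • ‖x‖⁻¹ • x) := by
      rw [hB, smul_sub, smul_sub, smul_smul, smul_smul, inner_smul_right, smul_smul, smul_smul]
      congr 2 <;> field_simp
    rw [mul_assoc, ← smul_eq_mul ‖x‖, ← map_smul, ← h5, h4]
    simp [h1B]
  have key := integral_fderiv_tangential v hsm hcs
  have hl : ∀ x : E n, inner ℝ v x * h x =
      (ψ ‖x‖ * ‖x‖) * (inner ℝ v (‖x‖⁻¹ • x) * G (‖x‖⁻¹ • x)) := fun x => by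
    by_cases hx : x = 0
    · simp [hx]
    have hx' : ‖x‖ ≠ 0 := by simpa using hx
    rw [inner_smul_right]
    simp only [hh]
    field_simp
  simp_rw [hder, hl] at key
  rw [integral_norm_mul_normalize volume (fun r => ψ r * r)
      (fun x => fderiv ℝ G x (v - inner ℝ v x • x)),
    integral_norm_mul_normalize volume (fun r => ψ r * r) (fun x => inner ℝ v x * G x),
    ← mul_assoc] at key
  -- The common radial factor of both sides is nonzero, so it can be cancelled.
  have hpos : 0 < ∫ x : E n, ψ ‖x‖ * ‖x‖ := by
    have hcont : Continuous fun x : E n => ψ ‖x‖ * ‖x‖ := (ψ.continuous.comp continuous_norm).mul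
      continuous_norm
    refine hcont.integral_pos_of_hasCompactSupport_nonneg_nonzero
      (x := EuclideanSpace.single 0 2) ?_ (fun x => mul_nonneg ψ.nonneg (norm_nonneg _)) ?_
    · refine HasCompactSupport.intro (isCompact_closedBall (0 : E n) 3) fun x hx => ?_
      have : 3 < ‖x‖ := by simpa using hx
      simp [hψ0 _ (Or.inr this.le)]
    · have : ψ (2 : ℝ) = 1 := ψ.one_of_mem_closedBall (by simp [ψ])
      simp [this]
  have hc := integral_norm_mul_normalize (volume : Measure (E n)) (fun r => ψ r * r) (fun _ => 1)
  simp only [mul_one] at hc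
  have hc0 : ∫ r, ψ (r : ℝ) * (r : ℝ) ∂(Measure.volumeIoiPow (Module.finrank ℝ (E n) - 1)) ≠ 0 := by
    intro h0
    rw [hc, h0, mul_zero] at hpos
    exact hpos.false
  have := mul_right_cancel₀ hc0 key
  rw [← this]
  refine integral_congr_ae (.of_forall fun ζ => ?_)
  exact inner_sphGrad v G ζ

/-! ### The weighted measure -/

lemma continuous_coord {n : ℕ} (i : Fin (n + 1)) : Continuous fun ζ : S n => (ζ : E n) i := by
  fun_prop

lemma isOpen_halfSpace (n : ℕ) : IsOpen (halfSpace n) :=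
  isOpen_lt continuous_const (by fun_prop)

lemma isOpen_upper (n : ℕ) : IsOpen (upper n) :=
  (isOpen_halfSpace n).preimage continuous_subtype_val

lemma measurable_weight (n : ℕ) (α : ℝ) :
    Measurable fun ζ : S n => ENNReal.ofReal ((ζ : E n) (Fin.last n) ^ α) :=
  ((continuous_coord _).measurable.pow_const α).ennreal_ofReal

lemma ae_mem_upper (n : ℕ) (α : ℝ) : ∀ᵐ ζ ∂(sigma n α), ζ ∈ upper n :=
  (withDensity_absolutelyContinuous _ _).ae_le (ae_restrict_mem (isOpen_upper n).measurableSet)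

lemma integral_sigma {n : ℕ} {α : ℝ} (f : S n → ℝ) :
    ∫ ζ, f ζ ∂(sigma n α) =
      ∫ ζ in upper n, (ζ : E n) (Fin.last n) ^ α * f ζ ∂(volume : Measure (E n)).toSphere := by
  rw [sigma, integral_withDensity_eq_integral_toReal_smul (measurable_weight n α)
    (.of_forall fun _ => ENNReal.ofReal_lt_top)]
  refine setIntegral_congr_fun (isOpen_upper n).measurableSet fun ζ hζ => ?_
  have : 0 < (ζ : E n) (Fin.last n) := hζ
  simp only [smul_eq_mul]
  rw [ENNReal.toReal_ofReal (by positivity)]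

lemma abs_coord_le_norm {n : ℕ} (x : E n) (i : Fin (n + 1)) : |x i| ≤ ‖x‖ := by
  simpa using PiLp.norm_apply_le x i

/-- For `-1 < α < 0` the weight is integrable: since it increases under dilations by factors less
than one, its integral over the half-sphere is controlled, in polar coordinates, by its integral
over the half-ball, hence over a cube, where `x_N ^ α` is integrable. -/
theorem isFiniteMeasure_sigma (n : ℕ) {α : ℝ} (hα : α ∈ Set.Ioo (-1 : ℝ) 0) :
    IsFiniteMeasure (sigma n α) := by
  constructor
  set H : E n → ℝ≥0∞ := (halfSpace n).indicator fun x => ENNReal.ofReal (x (Fin.last n) ^ α)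
    with hH
  have hHm : Measurable H := by
    refine Measurable.indicator ?_ (isOpen_halfSpace n).measurableSet
    have : Measurable fun x : E n => x (Fin.last n) := by fun_prop
    exact (this.pow_const α).ennreal_ofReal
  have hsig : sigma n α Set.univ = ∫⁻ ζ : S n, H ζ ∂(volume : Measure (E n)).toSphere := by
    rw [sigma, withDensity_apply _ MeasurableSet.univ, Measure.restrict_univ,
      ← lintegral_indicator (isOpen_upper n).measurableSet]
    rfl
  set g : Fin (n + 1) → ℝ → ℝ := fun i => if i = Fin.last n then
    (Set.Ioo (0 : ℝ) 1).indicator fun t => t ^ α else (Set.Icc (-1 : ℝ) 1).indicator 1 with hg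
  have hgi : ∀ i, Integrable (g i) := fun i => by
    by_cases hi : i = Fin.last n
    · simp only [hg, hi, if_true]
      rw [integrable_indicator_iff measurableSet_Ioo]
      exact (intervalIntegral.integrableOn_Ioo_rpow_iff one_pos).2 hα.1
    · simp only [hg, hi, if_false]
      rw [integrable_indicator_iff measurableSet_Icc]
      exact integrableOn_const (by simp) (by simp)
  have hprod : Integrable (fun x : Fin (n + 1) → ℝ => ∏ i, g i (x i)) volume :=
    Integrable.fintype_prod hgi
  have hprodE : Integrable (fun x : E n => ∏ i, g i (x i)) volume :=
    (EuclideanSpace.volume_preserving_symm_measurableEquiv_toLp (Fin (n + 1))).integrable_comp_of_integrable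
      hprod
  have hle : ∀ x : E n, (Set.Iio (1 : ℝ)).indicator 1 ‖x‖ * H (‖x‖⁻¹ • x) ≤
      ENNReal.ofReal (∏ i, g i (x i)) := fun x => by
    by_cases hx1 : ‖x‖ < 1
    swap
    · simp [hx1]
    by_cases hx : ‖x‖⁻¹ • x ∈ halfSpace n
    swap
    · simp [hH, hx]
    have h0 : x ≠ 0 := by
      rintro rfl
      simp [halfSpace] at hx
    have hpos : 0 < ‖x‖ := norm_pos_iff.2 h0
    have hxl : 0 < x (Fin.last n) := by
      have : 0 < ‖x‖⁻¹ * x (Fin.last n) := hx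
      exact (mul_pos_iff_of_pos_left (by positivity)).1 this
    have hval : ∏ i, g i (x i) = x (Fin.last n) ^ α := by
      -- On the unit ball all factors but the last are one.
      rw [Finset.prod_eq_single (Fin.last n)]
      · have : x (Fin.last n) < 1 :=
          ((le_abs_self _).trans (abs_coord_le_norm x _)).trans_lt hx1
        simp [hg, hxl, this]
      · intro i _ hi
        have := abs_le.1 ((abs_coord_le_norm x i).trans hx1.le)
        simp [hg, hi, this.1, this.2]
      · simp
    rw [hval]
    simp only [hH, Set.indicator_of_mem hx, Set.mem_Iio, hx1, Set.indicator_of_mem,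
      Pi.one_apply, one_mul]
    refine ENNReal.ofReal_le_ofReal (Real.rpow_le_rpow_of_nonpos hxl ?_ hα.2.le)
    simp only [PiLp.smul_apply, smul_eq_mul]
    exact le_mul_of_one_le_left hxl.le ((one_le_inv₀ hpos).2 hx1.le)
  have hlt : ∫⁻ x : E n, (Set.Iio (1 : ℝ)).indicator 1 ‖x‖ * H (‖x‖⁻¹ • x) < ⊤ :=
    (lintegral_mono hle).trans_lt hprodE.lintegral_lt_top
  rw [lintegral_norm_mul_normalize volume (measurable_one.indicator measurableSet_Iio) hHm,
    ← hsig] at hlt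
  have hc : ∫⁻ r, (Set.Iio (1 : ℝ)).indicator 1 (r : ℝ)
      ∂(Measure.volumeIoiPow (Module.finrank ℝ (E n) - 1)) ≠ 0 := by
    have h1 := Measure.volumeIoiPow_apply_Iio (Module.finrank ℝ (E n) - 1) ⟨1, Set.mem_Ioi.2 one_pos⟩
    have h2 : ∀ r : Set.Ioi (0 : ℝ), (Set.Iio (1 : ℝ)).indicator (1 : ℝ → ℝ≥0∞) (r : ℝ) =
        (Set.Iio (⟨1, Set.mem_Ioi.2 one_pos⟩ : Set.Ioi (0 : ℝ))).indicator 1 r := fun r => rfl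
    simp_rw [h2]
    rw [lintegral_indicator_one measurableSet_Iio, h1]
    simp
    positivity
  by_contra htop
  rw [not_lt, top_le_iff] at htop
  rw [htop, ENNReal.top_mul hc] at hlt
  exact hlt.false

lemma sigma_univ_ne_zero (n : ℕ) (α : ℝ) : sigma n α Set.univ ≠ 0 := by
  have hne : (upper n).Nonempty :=
    ⟨⟨EuclideanSpace.single (Fin.last n) 1, by simp⟩, by simp [upper, halfSpace]⟩
  intro h
  rw [sigma, withDensity_apply _ MeasurableSet.univ, Measure.restrict_univ,
    lintegral_eq_zero_iff (measurable_weight n α)] at h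
  have h2 : ∀ᵐ ζ ∂((volume : Measure (E n)).toSphere.restrict (upper n)), False := by
    filter_upwards [h, ae_restrict_mem (isOpen_upper n).measurableSet] with ζ h1 h2
    have h3 : 0 < (ζ : E n) (Fin.last n) := h2
    have h4 := Real.rpow_pos_of_pos h3 α
    simp only [Pi.zero_apply, ENNReal.ofReal_eq_zero] at h1
    linarith
  rw [Filter.eventually_false_iff_eq_bot, ae_eq_bot, Measure.restrict_eq_zero] at h2
  exact (isOpen_upper n).measure_ne_zero _ hne h2

/-! ### The weighted divergence theorem -/

/-- A smooth cut-off on `ℝ`, zero on `t ≤ 1 / (k + 1)` and one on `t ≥ 2 / (k + 1)`. -/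
def cutoff (k : ℕ) (t : ℝ) : ℝ := Real.smoothTransition ((k + 1) * t - 1)

lemma contDiff_cutoff (k : ℕ) : ContDiff ℝ 1 (cutoff k) :=
  Real.smoothTransition.contDiff.comp ((contDiff_const.mul contDiff_id).sub contDiff_const)

lemma cutoff_eq_zero {k : ℕ} {t : ℝ} (ht : (k + 1) * t ≤ 1) : cutoff k t = 0 :=
  Real.smoothTransition.zero_of_nonpos (by linarith)

lemma abs_cutoff_le_one (k : ℕ) (t : ℝ) : |cutoff k t| ≤ 1 := by
  rw [cutoff, abs_of_nonneg (Real.smoothTransition.nonneg _)]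
  exact Real.smoothTransition.le_one _

lemma eventually_cutoff_eventuallyEq_one {t : ℝ} (ht : 0 < t) :
    ∀ᶠ k : ℕ in Filter.atTop, cutoff k =ᶠ[nhds t] fun _ => 1 := by
  obtain ⟨K, hK⟩ := exists_nat_gt (2 / t)
  filter_upwards [Filter.eventually_ge_atTop K] with k hk
  have h1 : 2 < (k + 1 : ℝ) * t := by
    rw [div_lt_iff₀ ht] at hK
    have : (K : ℝ) ≤ k := by exact_mod_cast hk
    nlinarith
  have hc : ContinuousAt (fun s : ℝ => (k + 1 : ℝ) * s) t := by fun_prop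
  filter_upwards [hc.eventually (lt_mem_nhds h1)] with s hs
  exact Real.smoothTransition.one_of_one_le (by linarith)

lemma deriv_cutoff (k : ℕ) (t : ℝ) :
    deriv (cutoff k) t = (k + 1) * deriv Real.smoothTransition ((k + 1) * t - 1) := by
  have h1 : HasDerivAt (fun t : ℝ => (k + 1 : ℝ) * t - 1) (k + 1) t := by
    simpa using ((hasDerivAt_id t).const_mul (k + 1 : ℝ)).sub_const 1
  have h2 := ((Real.smoothTransition.contDiff (n := 1)).differentiable (by norm_num)
    ((k + 1) * t - 1)).hasDerivAt
  rw [mul_comm]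
  exact (h2.comp t h1).deriv

/-- The cut-offs vary on the scale on which they live. -/
lemma exists_abs_deriv_cutoff_mul_le : ∃ C, ∀ k t, |deriv (cutoff k) t * t| ≤ C := by
  have hcont : Continuous fun s : ℝ => deriv Real.smoothTransition s * (s + 1) :=
    ((Real.smoothTransition.contDiff (n := 1)).continuous_deriv (by norm_num)).mul (by fun_prop)
  have hcs : HasCompactSupport fun s : ℝ => deriv Real.smoothTransition s * (s + 1) := by
    refine HasCompactSupport.intro (isCompact_Icc (a := (0 : ℝ)) (b := 1)) fun s hs => ?_
    have : deriv Real.smoothTransition s = 0 := by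
      rcases lt_or_ge s 0 with h | h
      · have : Real.smoothTransition =ᶠ[nhds s] fun _ => 0 := by
          filter_upwards [gt_mem_nhds h] with r hr
          exact Real.smoothTransition.zero_of_nonpos hr.le
        rw [this.deriv_eq, deriv_const]
      · have h1 : 1 < s := by
          by_contra h1
          exact hs ⟨h, not_lt.1 h1⟩
        have : Real.smoothTransition =ᶠ[nhds s] fun _ => 1 := by
          filter_upwards [lt_mem_nhds h1] with r hr
          exact Real.smoothTransition.one_of_one_le hr.le
        rw [this.deriv_eq, deriv_const]
    simp [this]
  obtain ⟨C, hC⟩ := hcont.bounded_above_of_compact_support hcs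
  refine ⟨C, fun k t => ?_⟩
  have := hC ((k + 1) * t - 1)
  rw [Real.norm_eq_abs] at this
  refine le_of_eq_of_le ?_ this
  rw [deriv_cutoff]
  ring_nf

/-- The weighted divergence theorem for test functions vanishing near the equator: the divergence
theorem on the sphere applied to `cutoff k (x_N) * x_N ^ α * F`. -/
lemma integral_cutoff_inner_sphGrad {n : ℕ} (α : ℝ) {v : E n} (hv : v (Fin.last n) = 0)
    {F : E n → ℝ} (hF : ContDiffOn ℝ ∞ F (halfSpace n)) (k : ℕ) :
    ∫ ζ : S n, (cutoff k ((ζ : E n) (Fin.last n)) * inner ℝ v (sphGrad F ζ) -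
        (deriv (cutoff k) ((ζ : E n) (Fin.last n)) * (ζ : E n) (Fin.last n) +
          α * cutoff k ((ζ : E n) (Fin.last n))) * (inner ℝ v (ζ : E n) * F ζ)) ∂(sigma n α) =
      n * ∫ ζ : S n, cutoff k ((ζ : E n) (Fin.last n)) * (inner ℝ v (ζ : E n) * F ζ)
        ∂(sigma n α) := by
  have hFx : ∀ x ∈ halfSpace n, ContDiffAt ℝ 1 F x := fun x hx =>
    (hF.contDiffAt ((isOpen_halfSpace n).mem_nhds hx)).of_le (by exact_mod_cast le_top)
  set κ : ℝ → ℝ := fun t => cutoff k t * t ^ α with hκ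
  set G : E n → ℝ := fun x => κ (x (Fin.last n)) * F x with hG
  have hproj : ∀ x : E n, HasFDerivAt (fun x : E n => x (Fin.last n))
      (EuclideanSpace.proj (Fin.last n) : E n →L[ℝ] ℝ) x :=
    fun x => (EuclideanSpace.proj (Fin.last n) : E n →L[ℝ] ℝ).hasFDerivAt
  have hG0 : ∀ x : E n, x (Fin.last n) ≤ 0 → G =ᶠ[nhds x] fun _ => 0 := fun x hx => by
    have hc : Continuous fun x : E n => (k + 1 : ℝ) * x (Fin.last n) := by fun_prop
    have h1 : (k + 1 : ℝ) * x (Fin.last n) < 1 :=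
      (mul_nonpos_of_nonneg_of_nonpos (by positivity) hx).trans_lt one_pos
    filter_upwards [hc.continuousAt.eventually (gt_mem_nhds h1)] with y hy
    simp [hG, hκ, cutoff_eq_zero hy.le]
  have hGs : ContDiff ℝ 1 G := by
    rw [contDiff_iff_contDiffAt]
    intro x
    rcases le_or_gt (x (Fin.last n)) 0 with hx | hx
    · exact contDiffAt_const.congr_of_eventuallyEq (hG0 x hx)
    · have h1 : ContDiffAt ℝ 1 (fun x : E n => x (Fin.last n)) x :=
        (contDiff_piLp_apply 2).contDiffAt
      have h2 : ContDiffAt ℝ 1 κ (x (Fin.last n)) :=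
        (contDiff_cutoff k).contDiffAt.mul (Real.contDiffAt_rpow_const_of_ne hx.ne')
      exact (h2.comp x h1).mul (hFx x hx)
  have key := integral_inner_sphGrad v hGs
  have hz : ∀ ζ : S n, ζ ∉ upper n → G ζ = 0 ∧ inner ℝ v (sphGrad G ζ) = 0 := fun ζ hζ => by
    have h0 := hG0 ζ (not_lt.1 hζ)
    refine ⟨h0.self_of_nhds, ?_⟩
    rw [inner_sphGrad, h0.fderiv_eq]
    simp
  have hz1 : ∫ ζ in upper n, inner ℝ v (sphGrad G ζ) ∂(volume : Measure (E n)).toSphere =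
      ∫ ζ : S n, inner ℝ v (sphGrad G ζ) ∂(volume : Measure (E n)).toSphere :=
    setIntegral_eq_integral_of_forall_compl_eq_zero fun ζ hζ => (hz ζ hζ).2
  have hz2 : ∫ ζ in upper n, inner ℝ v (ζ : E n) * G ζ ∂(volume : Measure (E n)).toSphere =
      ∫ ζ : S n, inner ℝ v (ζ : E n) * G ζ ∂(volume : Measure (E n)).toSphere :=
    setIntegral_eq_integral_of_forall_compl_eq_zero fun ζ hζ => by simp [(hz ζ hζ).1]
  rw [← hz1, ← hz2] at key
  rw [integral_sigma, integral_sigma]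
  convert key using 1
  · refine setIntegral_congr_fun (isOpen_upper n).measurableSet fun ζ hζ => ?_
    have hpos : 0 < (ζ : E n) (Fin.last n) := hζ
    have hd : HasDerivAt κ _ ((ζ : E n) (Fin.last n)) :=
      ((contDiff_cutoff k).differentiable (by norm_num) _).hasDerivAt.mul
        (Real.hasDerivAt_rpow_const (p := α) (Or.inl hpos.ne'))
    have hGd := (hd.comp_hasFDerivAt (ζ : E n) (hproj ζ)).mul
      ((hFx ζ hζ).differentiableAt (by norm_num)).hasFDerivAt
    have hGd' : fderiv ℝ G ζ = _ := hGd.fderiv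
    simp only
    rw [inner_sphGrad v G, hGd', inner_sphGrad]
    simp [hv, hκ]
    rw [Real.rpow_sub_one hpos.ne']
    field_simp
    ring
  · congr 1
    refine setIntegral_congr_fun (isOpen_upper n).measurableSet fun ζ hζ => ?_
    simp only [hG, hκ]
    ring

/-- The weighted divergence theorem on the half-sphere for the field `F(ζ) (v - ⟪v, ζ⟫ ζ)`, with
`v` parallel to the equatorial hyperplane. There is no boundary term: the field is asymptotically
tangent to the equator, with normal component of order `ζ_N`, and `ζ_N ^ (1 + α)` vanishes there. -/
theorem integral_inner_sphGrad_sigma {n : ℕ} {α : ℝ} {v : E n} (hv : v (Fin.last n) = 0)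
    {F : E n → ℝ} (hF : ContDiffOn ℝ ∞ F (halfSpace n))
    (hFi : Integrable (fun ζ : S n => F ζ) (sigma n α))
    (hDi : Integrable (fun ζ : S n => inner ℝ v (sphGrad F ζ)) (sigma n α)) :
    ∫ ζ : S n, inner ℝ v (sphGrad F ζ) ∂(sigma n α) =
      (n + α) * ∫ ζ : S n, inner ℝ v (ζ : E n) * F ζ ∂(sigma n α) := by
  obtain ⟨C, hC⟩ := exists_abs_deriv_cutoff_mul_le
  have hvζ : ∀ ζ : S n, |inner ℝ v (ζ : E n)| ≤ ‖v‖ := fun ζ => by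
    simpa using abs_real_inner_le_norm v (ζ : E n)
  have hvc : Continuous fun ζ : S n => inner ℝ v (ζ : E n) := by fun_prop
  have hvF : Integrable (fun ζ : S n => inner ℝ v (ζ : E n) * F ζ) (sigma n α) :=
    hFi.bdd_mul (c := ‖v‖) hvc.aestronglyMeasurable (.of_forall hvζ)
  have hcm : ∀ k, Continuous fun ζ : S n => cutoff k ((ζ : E n) (Fin.last n)) := fun k =>
    (contDiff_cutoff k).continuous.comp (continuous_coord _)
  have hdm : ∀ k, Continuous fun ζ : S n => deriv (cutoff k) ((ζ : E n) (Fin.last n)) *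
      (ζ : E n) (Fin.last n) := fun k =>
    (((contDiff_cutoff k).continuous_deriv (by norm_num)).comp (continuous_coord _)).mul
      (continuous_coord _)
  have hone : ∀ᵐ ζ : S n ∂(sigma n α), ∀ᶠ k : ℕ in Filter.atTop,
      cutoff k ((ζ : E n) (Fin.last n)) = 1 ∧ deriv (cutoff k) ((ζ : E n) (Fin.last n)) = 0 := by
    filter_upwards [ae_mem_upper n α] with ζ hζ
    filter_upwards [eventually_cutoff_eventuallyEq_one (t := (ζ : E n) (Fin.last n)) hζ] with k hk
    exact ⟨hk.self_of_nhds, by rw [hk.deriv_eq, deriv_const]⟩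
  have hL := tendsto_integral_of_dominated_convergence (μ := sigma n α)
    (F := fun k (ζ : S n) => cutoff k ((ζ : E n) (Fin.last n)) * inner ℝ v (sphGrad F ζ) -
        (deriv (cutoff k) ((ζ : E n) (Fin.last n)) * (ζ : E n) (Fin.last n) +
          α * cutoff k ((ζ : E n) (Fin.last n))) * (inner ℝ v (ζ : E n) * F ζ))
    (f := fun ζ : S n => inner ℝ v (sphGrad F ζ) - α * (inner ℝ v (ζ : E n) * F ζ))
    (fun ζ => |inner ℝ v (sphGrad F ζ)| + (C + |α|) * |inner ℝ v (ζ : E n) * F ζ|)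
    (fun k => ((hcm k).aestronglyMeasurable.mul hDi.1).sub
      (((hdm k).add (continuous_const.mul (hcm k))).aestronglyMeasurable.mul hvF.1))
    (hDi.abs.add (hvF.abs.const_mul _))
    (fun k => .of_forall fun ζ => by
      rw [Real.norm_eq_abs]
      refine (abs_sub _ _).trans ?_
      rw [abs_mul, abs_mul]
      gcongr
      · exact mul_le_of_le_one_left (abs_nonneg _) (abs_cutoff_le_one _ _)
      · refine (abs_add_le _ _).trans (add_le_add (hC _ _) ?_)
        rw [abs_mul]
        exact mul_le_of_le_one_right (abs_nonneg _) (abs_cutoff_le_one _ _))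
    (by
      filter_upwards [hone] with ζ hζ
      refine tendsto_const_nhds.congr' ?_
      filter_upwards [hζ] with k hk
      simp [hk.1, hk.2])
  have hR := tendsto_integral_of_dominated_convergence (μ := sigma n α)
    (F := fun k (ζ : S n) => cutoff k ((ζ : E n) (Fin.last n)) * (inner ℝ v (ζ : E n) * F ζ))
    (f := fun ζ : S n => inner ℝ v (ζ : E n) * F ζ)
    (fun ζ => |inner ℝ v (ζ : E n) * F ζ|)
    (fun k => (hcm k).aestronglyMeasurable.mul hvF.1) hvF.abs
    (fun k => .of_forall fun ζ => by
      rw [Real.norm_eq_abs, abs_mul]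
      exact mul_le_of_le_one_left (abs_nonneg _) (abs_cutoff_le_one _ _))
    (by
      filter_upwards [hone] with ζ hζ
      refine tendsto_const_nhds.congr' ?_
      filter_upwards [hζ] with k hk
      simp [hk.1])
  simp_rw [integral_cutoff_inner_sphGrad α hv hF] at hL
  have := tendsto_nhds_unique hL (hR.const_mul (n : ℝ))
  rw [integral_sub hDi (hvF.const_mul α), integral_const_mul] at this
  linarith

/-! ### A spectral gap for operators that are triangular on a filtration -/

section Filtration

variable {A H K : Type*} [AddCommGroup A] [Module ℝ A]
  [NormedAddCommGroup H] [InnerProductSpace ℝ H] [NormedAddCommGroup K] [InnerProductSpace ℝ K]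

lemma exists_mem_inner_sub_eq_zero (ι : A →ₗ[ℝ] H) (V : Submodule ℝ A) [Module.Finite ℝ V]
    (u : H) : ∃ q ∈ V, ∀ r ∈ V, inner ℝ (ι r) (u - ι q) = 0 := by
  obtain ⟨q, hq, hqu⟩ := Submodule.mem_map.1 ((V.map ι).starProjection_apply_mem u)
  refine ⟨q, hq, fun r hr => ?_⟩
  rw [hqu]
  exact (Submodule.mem_orthogonal _ _).1 ((V.map ι).sub_starProjection_mem_orthogonal u) _
    (Submodule.mem_map_of_mem hr)

/-- An operator that is symmetric, preserves an increasing sequence of finite-dimensional spaces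
`V m` and acts on `V (m + 1)` modulo `V m` as the scalar `lam (m + 1) ≥ c` is bounded below by `c`
on the orthogonal complement of `V 0`. -/
lemma le_inner_of_triangular (ι : A →ₗ[ℝ] H) (T : A →ₗ[ℝ] A) (V : ℕ → Submodule ℝ A)
    [∀ m, Module.Finite ℝ (V m)] (hmono : Monotone V) (lam : ℕ → ℝ) {c : ℝ}
    (hlam : ∀ m, c ≤ lam (m + 1))
    (hsymm : ∀ p q, inner ℝ (ι (T p)) (ι q) = inner ℝ (ι p) (ι (T q)))
    (hT : ∀ m, ∀ p ∈ V m, T p ∈ V m)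
    (htri : ∀ m, ∀ p ∈ V (m + 1), T p - lam (m + 1) • p ∈ V m) (m : ℕ) :
    ∀ p ∈ V m, (∀ q ∈ V 0, inner ℝ (ι q) (ι p) = 0) →
      c * ‖ι p‖ ^ 2 ≤ inner ℝ (ι (T p)) (ι p) := by
  induction m with
  | zero =>
    intro p hp h0
    have : ι p = 0 := inner_self_eq_zero.1 (h0 p hp)
    simp [this]
  | succ m ih =>
    intro p hp h0
    obtain ⟨g, hg, hgr⟩ := exists_mem_inner_sub_eq_zero ι (V m) (ι p)
    set r := p - g with hr
    have hrV : r ∈ V (m + 1) := sub_mem hp (hmono m.le_succ hg)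
    have hpr : p = g + r := by simp [hr]
    have hort : ∀ q ∈ V m, inner ℝ (ι q) (ι r) = 0 := fun q hq => by
      rw [hr, map_sub]; exact hgr q hq
    have hg0 : ∀ q ∈ V 0, inner ℝ (ι q) (ι g) = 0 := fun q hq => by
      have h1 := h0 q hq
      rwa [hpr, map_add, inner_add_right, hort q (hmono m.zero_le hq), add_zero] at h1
    have h1 := ih g hg hg0
    have h2 : inner ℝ (ι (T g)) (ι r) = 0 := hort _ (hT m g hg)
    -- By symmetry `T` also respects the orthogonal splitting `ι p = ι g + ι r`.
    have h3 : inner ℝ (ι (T r)) (ι g) = 0 := by rw [hsymm, real_inner_comm, h2]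
    have h4 : inner ℝ (ι (T r)) (ι r) = lam (m + 1) * ‖ι r‖ ^ 2 := by
      have h5 := hort _ (htri m r hrV)
      rw [map_sub, map_smul, inner_sub_left, inner_smul_left, real_inner_self_eq_norm_sq] at h5
      simpa [sub_eq_zero] using h5
    have h6 : ‖ι p‖ ^ 2 = ‖ι g‖ ^ 2 + ‖ι r‖ ^ 2 := by
      rw [hpr, map_add, norm_add_sq_real, hort g hg]
      ring
    have h7 : inner ℝ (ι (T p)) (ι p) = inner ℝ (ι (T g)) (ι g) + lam (m + 1) * ‖ι r‖ ^ 2 := by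
      rw [hpr, map_add, map_add, map_add, inner_add_left, inner_add_right, inner_add_right, h2,
        h3, h4]
      ring
    rw [h6, h7, mul_add]
    exact add_le_add h1 (mul_le_mul_of_nonneg_right (hlam m) (sq_nonneg _))

/-- The gap `c` of a triangular operator `T` passes to the whole space when the image of `A` is
dense. Here `G` plays the role of a gradient, `T` that of the corresponding Laplacian, and `w` that
of the weak gradient of `u`; the projection of `u` onto `V m` has less energy than `u`. -/
theorem le_norm_sq_of_triangular (ι : A →ₗ[ℝ] H) (T : A →ₗ[ℝ] A) (G : A → K)
    (V : ℕ → Submodule ℝ A)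
    [∀ m, Module.Finite ℝ (V m)] (hmono : Monotone V) (lam : ℕ → ℝ) {c : ℝ} (hc : 0 ≤ c)
    (hlam : ∀ m, c ≤ lam (m + 1))
    (hG : ∀ p q, inner ℝ (G p) (G q) = inner ℝ (ι (T p)) (ι q))
    (hT : ∀ m, ∀ p ∈ V m, T p ∈ V m)
    (htri : ∀ m, ∀ p ∈ V (m + 1), T p - lam (m + 1) • p ∈ V m)
    (hV : ∀ p, ∃ m, p ∈ V m) (hdense : DenseRange ι) {u : H} {w : K}
    (hu : ∀ q ∈ V 0, inner ℝ (ι q) u = 0)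
    (hw : ∀ p, inner ℝ (G p) w = inner ℝ (ι (T p)) u) :
    c * ‖u‖ ^ 2 ≤ ‖w‖ ^ 2 := by
  have key : ∀ x : H, c * ‖u‖ ^ 2 ≤ ‖w‖ ^ 2 + c * ‖u - x‖ ^ 2 := by
    intro x
    refine hdense.induction_on x (isClosed_le (by fun_prop) (by fun_prop)) fun p => ?_
    obtain ⟨m, hm⟩ := hV p
    obtain ⟨q, hq, hqu⟩ := exists_mem_inner_sub_eq_zero ι (V m) u
    have hsplit : ∀ r ∈ V m, inner ℝ (ι r) u = inner ℝ (ι r) (ι q) := fun r hr => by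
      have := hqu r hr
      rw [inner_sub_right] at this
      linarith
    have h1 : c * ‖ι q‖ ^ 2 ≤ inner ℝ (ι (T q)) (ι q) :=
      le_inner_of_triangular ι T V hmono lam hlam
        (fun p q => by rw [← hG, real_inner_comm, hG, real_inner_comm]) hT htri m q hq
        fun r hr => by rw [← hsplit r (hmono m.zero_le hr), hu r hr]
    -- The energy of the projection `ι q` of `u` is at most that of `u`, by Cauchy–Schwarz.
    have h2 : ‖G q‖ ^ 2 ≤ ‖G q‖ * ‖w‖ := by
      rw [← real_inner_self_eq_norm_sq, hG, ← hsplit _ (hT m q hq), ← hw]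
      exact real_inner_le_norm _ _
    have h3 : ‖G q‖ ^ 2 ≤ ‖w‖ ^ 2 := by nlinarith [sq_nonneg (‖G q‖ - ‖w‖)]
    rw [← real_inner_self_eq_norm_sq, hG] at h3
    have h4 : ‖u‖ ^ 2 = ‖ι q‖ ^ 2 + ‖u - ι q‖ ^ 2 := by
      conv_lhs => rw [← add_sub_cancel (ι q) u]
      rw [norm_add_sq_real, hqu q hq]
      ring
    have h5 : ‖u - ι q‖ ^ 2 ≤ ‖u - ι p‖ ^ 2 := by
      have h6 : u - ι p = (u - ι q) + ι (q - p) := by rw [map_sub]; abel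
      have h7 : inner ℝ (u - ι q) (ι (q - p)) = 0 := by
        rw [real_inner_comm]
        exact hqu _ (sub_mem hq hm)
      rw [h6, norm_add_sq_real, h7]
      nlinarith [sq_nonneg ‖ι (q - p)‖]
    rw [h4, mul_add]
    exact add_le_add (h1.trans h3) (mul_le_mul_of_nonneg_left h5 hc)
  simpa using key u

end Filtration

/-! ### The weighted Laplacian on polynomials -/

open MvPolynomial

/-- The operator `p ↦ -ζ_N^{-α} Δ^α p` on polynomials in the coordinates `ζ_1, …, ζ_{N-1}` of the
half-sphere. Polynomials in these coordinates are its natural domain: they are even in `ζ_N`. -/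
def polyOp (n : ℕ) (α : ℝ) : MvPolynomial (Fin n) ℝ →ₗ[ℝ] MvPolynomial (Fin n) ℝ where
  toFun p := ∑ j, ((n + α) • (X j * pderiv j p) - pderiv j (pderiv j p) +
    X j * ∑ i, X i * pderiv i (pderiv j p))
  map_add' p q := by
    simp only [map_add, mul_add, smul_add, ← Finset.sum_add_distrib]
    refine Finset.sum_congr rfl fun j _ => ?_
    rw [Finset.sum_add_distrib, mul_add]
    abel
  map_smul' c p := by
    simp only [Derivation.map_smul, mul_smul_comm, RingHom.id_apply, Finset.smul_sum, smul_add, smul_sub,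
      smul_comm c, Finset.mul_sum]

lemma polyOp_apply (n : ℕ) (α : ℝ) (p : MvPolynomial (Fin n) ℝ) :
    polyOp n α p = ∑ j, ((n + α) • (X j * pderiv j p) - pderiv j (pderiv j p) +
      X j * ∑ i, X i * pderiv i (pderiv j p)) := rfl

/-- The eigenvalue `k (k + N - 2 + α)` of the weighted Laplacian at degree `k`. -/
def degreeEigenvalue (n : ℕ) (α : ℝ) (k : ℕ) : ℝ := k * (k + n - 1 + α)

lemma polyOp_of_isHomogeneous {n : ℕ} (α : ℝ) {k : ℕ} {p : MvPolynomial (Fin n) ℝ}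
    (hp : p.IsHomogeneous k) :
    polyOp n α p = degreeEigenvalue n α k • p - ∑ j, pderiv j (pderiv j p) := by
  have h1 : ∀ j, ∑ i, X i * pderiv i (pderiv j p) = (k - 1) • pderiv j p := fun j =>
    hp.pderiv.sum_X_mul_pderiv
  have h2 : ∑ j, X j * ((k - 1) • pderiv j p) = (k * (k - 1)) • p := by
    simp_rw [mul_smul_comm]
    rw [← Finset.smul_sum, hp.sum_X_mul_pderiv, smul_smul, mul_comm]
  rw [polyOp_apply, Finset.sum_add_distrib, Finset.sum_sub_distrib, ← Finset.smul_sum,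
    hp.sum_X_mul_pderiv]
  simp_rw [h1]
  rw [h2, ← Nat.cast_smul_eq_nsmul ℝ k p, ← Nat.cast_smul_eq_nsmul ℝ (k * (k - 1)) p, smul_smul,
    sub_add_eq_add_sub, ← add_smul]
  congr 2
  rw [degreeEigenvalue]
  rcases k with _ | k
  · simp
  · simp
    ring

lemma polyOp_sub_smul_eq_sum (n : ℕ) (α c : ℝ) (p : MvPolynomial (Fin n) ℝ) :
    polyOp n α p - c • p = ∑ k ∈ Finset.range (p.totalDegree + 1),
      ((degreeEigenvalue n α k - c) • homogeneousComponent k p -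
        ∑ j, pderiv j (pderiv j (homogeneousComponent k p))) := by
  conv_lhs => rw [← sum_homogeneousComponent p]
  rw [map_sum, Finset.smul_sum, ← Finset.sum_sub_distrib]
  refine Finset.sum_congr rfl fun k _ => ?_
  rw [polyOp_of_isHomogeneous α (homogeneousComponent_isHomogeneous k p), sub_smul]
  abel

lemma homogeneousComponent_mem_restrictTotalDegree {n m k : ℕ} (hk : k ≤ m)
    (p : MvPolynomial (Fin n) ℝ) : homogeneousComponent k p ∈ restrictTotalDegree (Fin n) ℝ m :=
  (mem_restrictTotalDegree _ _ _).2
    ((homogeneousComponent_isHomogeneous k p).totalDegree_le.trans hk)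

lemma sum_pderiv_pderiv_mem_restrictTotalDegree {n m k : ℕ} (hk : k ≤ m + 1)
    (p : MvPolynomial (Fin n) ℝ) :
    ∑ j, pderiv j (pderiv j (homogeneousComponent k p)) ∈ restrictTotalDegree (Fin n) ℝ m :=
  sum_mem fun _ _ => (mem_restrictTotalDegree _ _ _).2
    ((homogeneousComponent_isHomogeneous k p).pderiv.pderiv.totalDegree_le.trans (by omega))

lemma polyOp_mem_restrictTotalDegree {n : ℕ} (α : ℝ) (m : ℕ) (p : MvPolynomial (Fin n) ℝ)
    (hp : p ∈ restrictTotalDegree (Fin n) ℝ m) :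
    polyOp n α p ∈ restrictTotalDegree (Fin n) ℝ m := by
  rw [mem_restrictTotalDegree] at hp
  have h := polyOp_sub_smul_eq_sum n α 0 p
  rw [zero_smul, sub_zero] at h
  rw [h]
  refine sum_mem fun k hk => ?_
  have hk' : k ≤ m := by rw [Finset.mem_range] at hk; omega
  exact sub_mem (Submodule.smul_mem _ _ (homogeneousComponent_mem_restrictTotalDegree hk' p))
    (sum_pderiv_pderiv_mem_restrictTotalDegree (by omega) p)

lemma polyOp_sub_smul_mem_restrictTotalDegree {n : ℕ} (α : ℝ) (m : ℕ)
    (p : MvPolynomial (Fin n) ℝ) (hp : p ∈ restrictTotalDegree (Fin n) ℝ (m + 1)) :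
    polyOp n α p - degreeEigenvalue n α (m + 1) • p ∈ restrictTotalDegree (Fin n) ℝ m := by
  rw [mem_restrictTotalDegree] at hp
  rw [polyOp_sub_smul_eq_sum]
  refine sum_mem fun k hk => ?_
  rw [Finset.mem_range] at hk
  refine sub_mem ?_ (sum_pderiv_pderiv_mem_restrictTotalDegree (by omega) p)
  rcases Nat.lt_or_ge m k with h | h
  · have : k = m + 1 := by omega
    rw [this, sub_self, zero_smul]
    exact zero_mem _
  · exact Submodule.smul_mem _ _ (homogeneousComponent_mem_restrictTotalDegree h p)

lemma restrictTotalDegree_mono (n : ℕ) : Monotone (restrictTotalDegree (Fin n) ℝ) :=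
  fun _ _ h _ hp => (mem_restrictTotalDegree _ _ _).2
    (((mem_restrictTotalDegree _ _ _).1 hp).trans h)

lemma le_degreeEigenvalue_succ {n : ℕ} (hn : 1 ≤ n) {α : ℝ} (hα : -1 < α) (m : ℕ) :
    n + α ≤ degreeEigenvalue n α (m + 1) := by
  have h1 : (1 : ℝ) ≤ n := by exact_mod_cast hn
  have h2 : (0 : ℝ) ≤ m := m.cast_nonneg
  rw [degreeEigenvalue]
  push_cast
  nlinarith [mul_nonneg h2 h2, mul_nonneg h2 (by linarith : (0 : ℝ) ≤ n + α)]

/-! ### Polynomials as functions on the half-sphere -/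

/-- A polynomial in the first `n` coordinates, as a function on `ℝ^(n+1)`. -/
def polyFun {n : ℕ} (p : MvPolynomial (Fin n) ℝ) (x : E n) : ℝ :=
  eval (fun i : Fin n => x i.castSucc) p

lemma contDiff_polyFun {n : ℕ} (p : MvPolynomial (Fin n) ℝ) {k : WithTop ℕ∞} :
    ContDiff ℝ k (polyFun p) := by
  induction p using MvPolynomial.induction_on with
  | C a =>
    have h : polyFun (C a : MvPolynomial (Fin n) ℝ) = fun _ => a := by funext y; simp [polyFun]
    exact h ▸ contDiff_const
  | add p q hp hq =>
    have h : polyFun (p + q) = fun x => polyFun p x + polyFun q x := by funext y; simp [polyFun]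
    exact h ▸ ContDiff.add hp hq
  | mul_X p i hp =>
    have h1 : ContDiff ℝ k fun x : E n => x i.castSucc := contDiff_piLp_apply 2
    have h : polyFun (p * X i) = fun x => polyFun p x * x i.castSucc := by
      funext y; simp [polyFun]
    exact h ▸ ContDiff.mul hp h1

lemma fderiv_polyFun {n : ℕ} (p : MvPolynomial (Fin n) ℝ) (x w : E n) :
    fderiv ℝ (polyFun p) x w = ∑ j, polyFun (pderiv j p) x * w j.castSucc := by
  have hd : ∀ q : MvPolynomial (Fin n) ℝ, DifferentiableAt ℝ (polyFun q) x := fun q =>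
    (contDiff_polyFun q (k := 1)).differentiable (by norm_num) x
  induction p using MvPolynomial.induction_on with
  | C a =>
    have : polyFun (C a : MvPolynomial (Fin n) ℝ) = fun _ => a := by
      funext y; simp [polyFun]
    rw [this]
    simp [polyFun]
  | add p q hp hq =>
    have : polyFun (p + q) = polyFun p + polyFun q := by funext y; simp [polyFun]
    rw [this, fderiv_add (hd p) (hd q), add_apply, hp, hq,
      ← Finset.sum_add_distrib]
    refine Finset.sum_congr rfl fun j _ => ?_
    simp [polyFun, add_mul]
  | mul_X p i hp =>
    have h1 : HasFDerivAt (fun x : E n => x i.castSucc)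
        (EuclideanSpace.proj i.castSucc : E n →L[ℝ] ℝ) x :=
      (EuclideanSpace.proj i.castSucc : E n →L[ℝ] ℝ).hasFDerivAt
    have h2 := (hd p).hasFDerivAt.mul h1
    have h3 : polyFun (p * X i) = polyFun p * fun x : E n => x i.castSucc := by
      funext y; simp [polyFun]
    have h4 : fderiv ℝ (polyFun (p * X i)) x = _ := h3 ▸ h2.fderiv
    rw [h4]
    simp only [add_apply, smul_apply, hp, smul_eq_mul,
      PiLp.proj_apply, Derivation.leibniz, pderiv_X, polyFun, map_add, map_mul, eval_X,
      add_mul, Finset.sum_add_distrib, Finset.mul_sum]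
    simp [Pi.single_apply, mul_assoc, apply_ite (eval fun i : Fin n => x i.castSucc)]

lemma inner_self_sphGrad {n : ℕ} (F : E n → ℝ) (ζ : S n) :
    inner ℝ (ζ : E n) (sphGrad F ζ) = 0 := by
  rw [inner_sphGrad]
  simp

lemma inner_sphGrad_polyFun {n : ℕ} (v : E n) (p : MvPolynomial (Fin n) ℝ) (ζ : S n) :
    inner ℝ v (sphGrad (polyFun p) ζ) = ∑ j : Fin n, polyFun (pderiv j p) ζ *
      (v j.castSucc - inner ℝ v (ζ : E n) * (ζ : E n) j.castSucc) := by
  rw [inner_sphGrad, fderiv_polyFun]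
  simp

lemma inner_sphGrad_polyFun_sphGrad {n : ℕ} (p : MvPolynomial (Fin n) ℝ) (F : E n → ℝ) (ζ : S n) :
    inner ℝ (sphGrad (polyFun p) ζ) (sphGrad F ζ) = ∑ j : Fin n, polyFun (pderiv j p) ζ *
      inner ℝ (EuclideanSpace.single j.castSucc (1 : ℝ)) (sphGrad F ζ) := by
  rw [real_inner_comm, inner_sphGrad_polyFun, real_inner_comm, inner_self_sphGrad]
  simp [EuclideanSpace.inner_single_left]

lemma inner_sphGrad_mul {n : ℕ} (v : E n) {P F : E n → ℝ} {ζ : S n}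
    (hP : DifferentiableAt ℝ P ζ) (hF : DifferentiableAt ℝ F ζ) :
    inner ℝ v (sphGrad (fun x => P x * F x) ζ) =
      P ζ * inner ℝ v (sphGrad F ζ) + F ζ * inner ℝ v (sphGrad P ζ) := by
  rw [inner_sphGrad, inner_sphGrad, inner_sphGrad, fderiv_fun_mul hP hF]
  simp

lemma continuous_sphGrad_polyFun {n : ℕ} (p : MvPolynomial (Fin n) ℝ) :
    Continuous fun ζ : S n => sphGrad (polyFun p) ζ := by
  have h : Continuous (gradient (polyFun p)) := by
    have := (contDiff_polyFun p (k := 1)).continuous_fderiv (by norm_num)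
    exact (InnerProductSpace.toDual ℝ (E n)).symm.continuous.comp this
  have h2 : Continuous fun ζ : S n => gradient (polyFun p) (ζ : E n) :=
    h.comp continuous_subtype_val
  unfold sphGrad
  fun_prop

lemma integrable_continuous_mul {n : ℕ} {μ : Measure (S n)} {g f : S n → ℝ} (hg : Continuous g)
    (hf : Integrable f μ) : Integrable (fun ζ => g ζ * f ζ) μ := by
  obtain ⟨C, hC⟩ := isCompact_univ.exists_bound_of_continuousOn hg.continuousOn
  exact hf.bdd_mul (c := C) hg.aestronglyMeasurable (.of_forall fun ζ => hC ζ (Set.mem_univ _))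

/-- Integration by parts: `polyOp` is minus the weighted Laplacian with Neumann condition. Write
`∇p · ∇F = ∑ ∂_j p e_j · ∇F` and apply the weighted divergence theorem to each `∂_j p F`. -/
theorem integral_inner_sphGrad_polyFun {n : ℕ} {α : ℝ} (p : MvPolynomial (Fin n) ℝ) {F : E n → ℝ}
    (hF : ContDiffOn ℝ ∞ F (halfSpace n)) (hFi : Integrable (fun ζ : S n => F ζ) (sigma n α))
    (hDi : Integrable (fun ζ : S n => sphGrad F ζ) (sigma n α)) :
    ∫ ζ : S n, inner ℝ (sphGrad (polyFun p) ζ) (sphGrad F ζ) ∂(sigma n α) =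
      ∫ ζ : S n, polyFun (polyOp n α p) ζ * F ζ ∂(sigma n α) := by
  set e : Fin n → E n := fun j => EuclideanSpace.single j.castSucc 1 with he
  have hc : ∀ q : MvPolynomial (Fin n) ℝ, Continuous fun ζ : S n => polyFun q ζ := fun q =>
    (contDiff_polyFun q (k := 0)).continuous.comp continuous_subtype_val
  have hgc : ∀ (q : MvPolynomial (Fin n) ℝ) j,
      Continuous fun ζ : S n => inner ℝ (e j) (sphGrad (polyFun q) ζ) := fun q j =>
    continuous_const.inner (continuous_sphGrad_polyFun q)
  have hDj : ∀ j, Integrable (fun ζ : S n => inner ℝ (e j) (sphGrad F ζ)) (sigma n α) :=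
    fun j => hDi.const_inner (e j)
  have h1 : ∀ j, Integrable (fun ζ : S n => polyFun (pderiv j p) ζ *
      inner ℝ (e j) (sphGrad F ζ)) (sigma n α) := fun j =>
    integrable_continuous_mul (hc _) (hDj j)
  have h2 : ∀ j, Integrable (fun ζ : S n =>
      inner ℝ (e j) (sphGrad (polyFun (pderiv j p)) ζ) * F ζ) (sigma n α) := fun j =>
    integrable_continuous_mul (hgc _ j) hFi
  have h3 : ∀ j, (fun ζ : S n => inner ℝ (e j) (sphGrad (fun x => polyFun (pderiv j p) x * F x) ζ))
      =ᵐ[sigma n α] fun ζ => polyFun (pderiv j p) ζ * inner ℝ (e j) (sphGrad F ζ) +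
        inner ℝ (e j) (sphGrad (polyFun (pderiv j p)) ζ) * F ζ := fun j => by
    filter_upwards [ae_mem_upper n α] with ζ hζ
    rw [inner_sphGrad_mul _ ((contDiff_polyFun _ (k := 1)).differentiable (by norm_num) _)
      ((hF.contDiffAt ((isOpen_halfSpace n).mem_nhds hζ)).differentiableAt (by simp))]
    ring
  have h4 : ∀ j, Integrable (fun ζ : S n => polyFun (pderiv j p) ζ * F ζ) (sigma n α) := fun j =>
    integrable_continuous_mul (hc _) hFi
  have h5 : ∀ j, Integrable (fun ζ : S n => inner ℝ (e j) (ζ : E n) *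
      (polyFun (pderiv j p) ζ * F ζ)) (sigma n α) := fun j =>
    integrable_continuous_mul (by fun_prop) (h4 j)
  have h6 : ∀ j, ∫ ζ : S n, polyFun (pderiv j p) ζ * inner ℝ (e j) (sphGrad F ζ) ∂(sigma n α) =
      ∫ ζ : S n, ((n + α) * (inner ℝ (e j) (ζ : E n) * (polyFun (pderiv j p) ζ * F ζ)) -
        inner ℝ (e j) (sphGrad (polyFun (pderiv j p)) ζ) * F ζ) ∂(sigma n α) := fun j => by
    have h7 := integral_inner_sphGrad_sigma (α := α) (v := e j) (by simp [he])
      (F := fun x => polyFun (pderiv j p) x * F x) ((contDiff_polyFun _).contDiffOn.mul hF) (h4 j)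
      (((h1 j).add (h2 j)).congr (h3 j).symm)
    rw [integral_congr_ae (h3 j), integral_add (h1 j) (h2 j)] at h7
    rw [integral_sub ((h5 j).const_mul _) (h2 j), integral_const_mul, ← h7]
    ring
  simp_rw [inner_sphGrad_polyFun_sphGrad]
  rw [integral_finsetSum _ fun j _ => h1 j]
  simp_rw [h6]
  -- Summing over `j`, the integrand on the right becomes `polyOp p` times `F`.
  have h7 : ∀ j, Integrable (fun ζ : S n => (n + α) * (inner ℝ (e j) (ζ : E n) *
      (polyFun (pderiv j p) ζ * F ζ)) -
        inner ℝ (e j) (sphGrad (polyFun (pderiv j p)) ζ) * F ζ) (sigma n α) := fun j =>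
    ((h5 j).const_mul _).sub (h2 j)
  rw [← integral_finsetSum _ fun j _ => h7 j]
  refine integral_congr_ae (.of_forall fun ζ => ?_)
  have h8 : polyFun (polyOp n α p) ζ = ∑ j, ((n + α) * ((ζ : E n) j.castSucc *
      polyFun (pderiv j p) ζ) - polyFun (pderiv j (pderiv j p)) ζ +
      (ζ : E n) j.castSucc * ∑ i : Fin n, (ζ : E n) i.castSucc *
        polyFun (pderiv i (pderiv j p)) ζ) := by
    rw [polyOp_apply]
    simp [polyFun, smul_eval]
  simp only
  rw [h8, Finset.sum_mul]
  refine Finset.sum_congr rfl fun j _ => ?_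
  rw [inner_sphGrad_polyFun]
  simp only [he, EuclideanSpace.inner_single_left, map_one, one_mul, mul_sub,
    Finset.sum_sub_distrib]
  have h9 : ∑ i : Fin n, polyFun (pderiv i (pderiv j p)) ζ *
      (EuclideanSpace.single j.castSucc (1 : ℝ) : E n) i.castSucc =
      polyFun (pderiv j (pderiv j p)) ζ := by
    simp
  have h10 : ∑ i : Fin n, polyFun (pderiv i (pderiv j p)) ζ *
      ((ζ : E n) j.castSucc * (ζ : E n) i.castSucc) =
      (ζ : E n) j.castSucc * ∑ i : Fin n, (ζ : E n) i.castSucc *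
        polyFun (pderiv i (pderiv j p)) ζ := by
    rw [Finset.mul_sum]
    exact Finset.sum_congr rfl fun i _ => by ring
  rw [h9, h10]
  ring

/-! ### Polynomials in the weighted Sobolev space -/

section Lp

variable {n : ℕ} {α : ℝ} [IsFiniteMeasure (sigma n α)]

/-- Polynomials in the first `n` coordinates as continuous functions on the sphere. -/
def polyC (n : ℕ) : MvPolynomial (Fin n) ℝ →ₐ[ℝ] C(S n, ℝ) :=
  aeval fun i => ⟨fun ζ : S n => (ζ : E n) i.castSucc, continuous_coord _⟩

lemma polyC_apply (p : MvPolynomial (Fin n) ℝ) (ζ : S n) : polyC n p ζ = polyFun p ζ := by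
  induction p using MvPolynomial.induction_on with
  | C a => simp [polyC, polyFun]
  | add p q hp hq => simp [hp, hq, polyFun]
  | mul_X p i hp =>
    rw [map_mul, ContinuousMap.mul_apply, hp]
    simp [polyFun, polyC]

variable (n α) in
/-- The class in `L²(σ_α)` of a polynomial in the first `n` coordinates. -/
def polyLp : MvPolynomial (Fin n) ℝ →ₗ[ℝ] Lp ℝ 2 (sigma n α) :=
  (ContinuousMap.toLp 2 (sigma n α) ℝ).toLinearMap ∘ₗ (polyC n).toLinearMap

lemma coeFn_polyLp (p : MvPolynomial (Fin n) ℝ) :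
    polyLp n α p =ᵐ[sigma n α] fun ζ => polyFun p ζ := by
  filter_upwards [ContinuousMap.coeFn_toLp (p := 2) (𝕜 := ℝ) (sigma n α) (polyC n p)] with ζ hζ
  rw [← polyC_apply]
  exact hζ

variable (α) in
/-- The class in `L²(σ_α)` of the tangential gradient of a polynomial. -/
def gradLp (p : MvPolynomial (Fin n) ℝ) : Lp (E n) 2 (sigma n α) :=
  ContinuousMap.toLp 2 (sigma n α) ℝ ⟨_, continuous_sphGrad_polyFun p⟩

lemma coeFn_gradLp (p : MvPolynomial (Fin n) ℝ) :
    gradLp α p =ᵐ[sigma n α] sphGrad (polyFun p) :=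
  ContinuousMap.coeFn_toLp _ _

lemma polyLp_gradLp_mem_W12 (p : MvPolynomial (Fin n) ℝ) :
    (polyLp n α p, gradLp α p) ∈ W12 n α :=
  subset_closure ⟨polyFun p, (contDiff_polyFun p).contDiffOn, coeFn_polyLp p, coeFn_gradLp p⟩

/-- The weak form of the Neumann problem for polynomials, tested against all of `W^{1,2}`. -/
theorem inner_gradLp (p : MvPolynomial (Fin n) ℝ)
    {u : Lp ℝ 2 (sigma n α) × Lp (E n) 2 (sigma n α)} (hu : u ∈ W12 n α) :
    inner ℝ (gradLp α p) u.2 = inner ℝ (polyLp n α (polyOp n α p)) u.1 := by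
  refine closure_minimal (t := {u : Lp ℝ 2 (sigma n α) × Lp (E n) 2 (sigma n α) |
    inner ℝ (gradLp α p) u.2 = inner ℝ (polyLp n α (polyOp n α p)) u.1}) ?_
    (isClosed_eq (by fun_prop) (by fun_prop)) hu
  rintro ⟨u, w⟩ ⟨F, hF, huF, hwF⟩
  have hFi : Integrable (fun ζ : S n => F ζ) (sigma n α) :=
    ((Lp.memLp u).integrable (by norm_num)).congr huF
  have hDi : Integrable (fun ζ : S n => sphGrad F ζ) (sigma n α) :=
    ((Lp.memLp w).integrable (by norm_num)).congr hwF
  rw [Set.mem_ofPred_eq, L2.inner_def, L2.inner_def]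
  have h1 : ∫ ζ, inner ℝ (gradLp α p ζ) (w ζ) ∂(sigma n α) =
      ∫ ζ : S n, inner ℝ (sphGrad (polyFun p) ζ) (sphGrad F ζ) ∂(sigma n α) := by
    refine integral_congr_ae ?_
    filter_upwards [coeFn_gradLp (α := α) p, hwF] with ζ h1 h2
    rw [h1, h2]
  have h2 : ∫ ζ, inner ℝ (polyLp n α (polyOp n α p) ζ) (u ζ) ∂(sigma n α) =
      ∫ ζ : S n, polyFun (polyOp n α p) ζ * F ζ ∂(sigma n α) := by
    refine integral_congr_ae ?_
    filter_upwards [coeFn_polyLp (α := α) (polyOp n α p), huF] with ζ h1 h2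
    rw [h1, h2]
    simp [mul_comm]
  rw [h1, h2]
  exact integral_inner_sphGrad_polyFun p hF hFi hDi

/-- Polynomials in `ζ_1, …, ζ_{N-1}` are dense in `L²(σ_α)`: on the closed upper half-sphere these
coordinates determine `ζ_N`, so they separate points and Stone–Weierstrass applies. -/
theorem denseRange_polyLp : DenseRange (polyLp n α) := by
  set K : Set (S n) := {ζ | 0 ≤ (ζ : E n) (Fin.last n)} with hK
  have hKc : CompactSpace K := isCompact_iff_compactSpace.1
    (isClosed_le continuous_const (continuous_coord _)).isCompact
  set res : C(S n, ℝ) →ₐ[ℝ] C(K, ℝ) :=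
    ContinuousMap.compRightAlgHom ℝ ℝ ⟨Subtype.val, continuous_subtype_val⟩ with hres
  have hsep : (res.comp (polyC n)).range.SeparatesPoints := by
    intro x y hxy
    by_contra hne
    apply hxy
    have hco : ∀ i : Fin n, (x.1 : E n) i.castSucc = (y.1 : E n) i.castSucc := fun i => by
      by_contra h
      refine hne ⟨_, ⟨_, ⟨X i, rfl⟩, rfl⟩, ?_⟩
      simpa [hres, polyC] using h
    have hlast : (x.1 : E n) (Fin.last n) = (y.1 : E n) (Fin.last n) := by
      have hn : ∀ z : S n, ∑ i : Fin n, (z : E n) i.castSucc ^ 2 +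
          (z : E n) (Fin.last n) ^ 2 = 1 := fun z => by
        rw [← Fin.sum_univ_castSucc (fun i => (z : E n) i ^ 2), ← EuclideanSpace.real_norm_sq_eq]
        simp
      have h1 := hn x.1
      have h2 := hn y.1
      simp_rw [hco] at h1
      exact (sq_eq_sq₀ x.2 y.2).1 (by linarith)
    refine Subtype.ext (Subtype.ext ?_)
    ext i
    exact Fin.lastCases hlast hco i
  have hdense := ContinuousMap.toLp_denseRange ℝ (sigma n α) ℝ (p := 2) (by norm_num)
  intro u
  rw [Metric.mem_closure_iff]
  intro ε hε
  obtain ⟨f, hf⟩ := hdense.exists_dist_lt u (half_pos hε)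
  set M : ℝ := (measureUnivNNReal (sigma n α) : ℝ) ^ (2 : ℝ≥0∞).toReal⁻¹ with hM
  have hM0 : 0 ≤ M := by positivity
  set δ : ℝ := ε / 2 / (M + 1) with hδ
  have hδ0 : 0 < δ := by positivity
  obtain ⟨⟨_, ⟨p, rfl⟩⟩, hp⟩ :=
    ContinuousMap.exists_mem_subalgebra_near_continuousMap_of_separatesPoints _ hsep (res f) δ hδ0
  refine ⟨_, ⟨p, rfl⟩, ?_⟩
  have hbd : ‖ContinuousMap.toLp 2 (sigma n α) ℝ f - polyLp n α p‖ ≤ M * δ := by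
    refine Lp.norm_le_of_ae_bound hδ0.le ?_
    filter_upwards [ContinuousMap.coeFn_toLp (p := 2) (𝕜 := ℝ) (sigma n α) f,
      coeFn_polyLp (α := α) p, ae_mem_upper n α,
      Lp.coeFn_sub (ContinuousMap.toLp 2 (sigma n α) ℝ f) (polyLp n α p)] with ζ h1 h2 h3 h4
    have h3' : 0 < (ζ : E n) (Fin.last n) := h3
    have hζ : ζ ∈ K := h3'.le
    have h5 := (ContinuousMap.norm_coe_le_norm _ (⟨ζ, hζ⟩ : K)).trans hp.le
    rw [h4, Pi.sub_apply, h1, h2, norm_sub_rev, ← polyC_apply]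
    exact h5
  have hMδ : M * δ < ε / 2 := by
    rw [hδ, ← mul_div_assoc, div_lt_iff₀ (by positivity)]
    nlinarith
  calc dist u (polyLp n α p) ≤ dist u (ContinuousMap.toLp 2 (sigma n α) ℝ f) +
        dist (ContinuousMap.toLp 2 (sigma n α) ℝ f) (polyLp n α p) := dist_triangle _ _ _
    _ < ε / 2 + ε / 2 := add_lt_add hf (by rw [dist_eq_norm]; exact hbd.trans_lt hMδ)
    _ = ε := by ring

end Lp

/-! ### The spectral gap on the half-sphere -/

section Gap

variable {n : ℕ} {α : ℝ}

lemma norm_sq_eq_integral_sq (u : Lp ℝ 2 (sigma n α)) : ‖u‖ ^ 2 = ∫ ζ, u ζ ^ 2 ∂(sigma n α) := by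
  rw [← real_inner_self_eq_norm_sq, L2.inner_def]
  simp

lemma norm_sq_eq_integral_norm_sq (w : Lp (E n) 2 (sigma n α)) :
    ‖w‖ ^ 2 = ∫ ζ, ‖w ζ‖ ^ 2 ∂(sigma n α) := by
  rw [← real_inner_self_eq_norm_sq, L2.inner_def]
  simp

lemma polyOp_C (a : ℝ) : polyOp n α (C a) = 0 := by simp [polyOp_apply]

lemma polyOp_X (j : Fin n) : polyOp n α (X j) = (n + α) • X j := by
  simp [polyOp_apply, pderiv_X, Pi.single_apply, apply_ite (pderiv _)]

variable [IsFiniteMeasure (sigma n α)]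

lemma coeFn_polyLp_C (a : ℝ) : polyLp n α (C a) =ᵐ[sigma n α] fun _ => a := by
  filter_upwards [coeFn_polyLp (n := n) (α := α) (C a)] with ζ hζ
  rw [hζ, polyFun, eval_C]

lemma inner_polyLp_one (u : Lp ℝ 2 (sigma n α)) :
    inner ℝ (polyLp n α (C 1)) u = ∫ ζ, u ζ ∂(sigma n α) := by
  rw [L2.inner_def]
  refine integral_congr_ae ?_
  filter_upwards [coeFn_polyLp_C (n := n) (α := α) 1] with ζ hζ
  rw [hζ]
  simp

/-- Polynomials and constants are orthogonal in energy. -/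
lemma inner_polyLp_polyOp_C (p : MvPolynomial (Fin n) ℝ) (a : ℝ) :
    inner ℝ (polyLp n α (polyOp n α p)) (polyLp n α (C a)) = 0 := by
  rw [← inner_gradLp p (polyLp_gradLp_mem_W12 (C a)), real_inner_comm,
    inner_gradLp (C a) (polyLp_gradLp_mem_W12 p), polyOp_C, map_zero, inner_zero_left]

/-- The Wirtinger inequality. Subtracting the mean `a` from `u` leaves its gradient unchanged, so the
pair `(u - a, ∇u)` still satisfies the integration by parts formula against polynomials. -/
theorem mul_norm_sub_sq_le (hn : 1 ≤ n) (hα : -1 < α)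
    {u : Lp ℝ 2 (sigma n α) × Lp (E n) 2 (sigma n α)} (hu : u ∈ W12 n α) {a : ℝ}
    (ha : inner ℝ (polyLp n α (C 1)) (u.1 - polyLp n α (C a)) = 0) :
    (n + α) * ‖u.1 - polyLp n α (C a)‖ ^ 2 ≤ ‖u.2‖ ^ 2 := by
  have h1 : (1 : ℝ) ≤ n := by exact_mod_cast hn
  refine le_norm_sq_of_triangular (polyLp n α) (polyOp n α) (gradLp α)
    (restrictTotalDegree (Fin n) ℝ) (restrictTotalDegree_mono n) (degreeEigenvalue n α)
    (by linarith) (le_degreeEigenvalue_succ hn hα)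
    (fun p q => inner_gradLp p (polyLp_gradLp_mem_W12 q))
    (polyOp_mem_restrictTotalDegree α) (polyOp_sub_smul_mem_restrictTotalDegree α)
    (fun p => ⟨p.totalDegree, (mem_restrictTotalDegree _ _ _).2 le_rfl⟩) denseRange_polyLp
    (fun q hq => ?_) fun p => ?_
  · rw [mem_restrictTotalDegree, Nat.le_zero, totalDegree_eq_zero_iff_eq_C] at hq
    have : (C (coeff 0 q) : MvPolynomial (Fin n) ℝ) = coeff 0 q • C 1 := by
      simp [smul_eq_C_mul]
    rw [hq, this, map_smul, inner_smul_left, ha, mul_zero]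
  · rw [inner_gradLp p hu, inner_sub_right, inner_polyLp_polyOp_C, sub_zero]

lemma mul_norm_sq_le (hn : 1 ≤ n) (hα : -1 < α)
    {u : Lp ℝ 2 (sigma n α) × Lp (E n) 2 (sigma n α)} (hu : u ∈ W12 n α)
    (h0 : ∫ ζ, u.1 ζ ∂(sigma n α) = 0) : (n + α) * ‖u.1‖ ^ 2 ≤ ‖u.2‖ ^ 2 := by
  have := mul_norm_sub_sq_le hn hα hu (a := 0)
    (by rw [C_0, map_zero, sub_zero, inner_polyLp_one, h0])
  rwa [C_0, map_zero, sub_zero] at this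

/-! ### The coordinate functions are extremal -/

lemma inner_gradLp_X (j : Fin n) {φ : Lp ℝ 2 (sigma n α) × Lp (E n) 2 (sigma n α)}
    (hφ : φ ∈ W12 n α) :
    inner ℝ (gradLp α (X j)) φ.2 = (n + α) * inner ℝ (polyLp n α (X j)) φ.1 := by
  rw [inner_gradLp _ hφ, polyOp_X, map_smul, inner_smul_left]
  rfl

lemma norm_gradLp_X_sq (j : Fin n) :
    ‖gradLp α (X j)‖ ^ 2 = (n + α) * ‖polyLp n α (X j)‖ ^ 2 := by
  have := inner_gradLp_X j (polyLp_gradLp_mem_W12 (α := α) (X j))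
  rwa [real_inner_self_eq_norm_sq, real_inner_self_eq_norm_sq] at this

lemma integral_polyLp_X (hα : 0 < n + α) (j : Fin n) :
    ∫ ζ, polyLp n α (X j) ζ ∂(sigma n α) = 0 := by
  have := inner_polyLp_polyOp_C (α := α) (X j) 1
  rw [polyOp_X, map_smul, inner_smul_left, real_inner_comm, inner_polyLp_one] at this
  exact (mul_eq_zero.1 this).resolve_left hα.ne'

/-- A coordinate vanishing almost everywhere would have zero gradient, yet `e_j · ∇ζ_j = 1 - ζ_j²`. -/
lemma polyLp_X_ne_zero (j : Fin n) : polyLp n α (X j) ≠ 0 := by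
  intro h0
  have hg : gradLp α (X j) = 0 := by
    have := norm_gradLp_X_sq (α := α) j
    rw [h0] at this
    simpa using this
  have hfalse : ∀ᵐ _ζ ∂(sigma n α), False := by
    filter_upwards [coeFn_polyLp (α := α) (X j), coeFn_gradLp (α := α) (X j),
      Lp.coeFn_zero ℝ 2 (sigma n α), Lp.coeFn_zero (E n) 2 (sigma n α)] with ζ h1 h2 h3 h4
    rw [h0, h3] at h1
    rw [hg, h4] at h2
    have h5 : (ζ : E n) j.castSucc = 0 := by simpa [polyFun] using h1.symm
    have h6 := inner_sphGrad_polyFun (EuclideanSpace.single j.castSucc (1 : ℝ)) (X j) ζ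
    rw [← h2] at h6
    simp [EuclideanSpace.inner_single_left, h5, polyFun, pderiv_X, Pi.single_apply] at h6
  rw [Filter.eventually_false_iff_eq_bot, ae_eq_bot] at hfalse
  exact sigma_univ_ne_zero n α (by rw [hfalse]; simp)

end Gap

end HalfSphere

end

open HalfSphere in
/-- With `N = n + 1 ≥ 2` and `α ∈ (-1, 0)`, the first nontrivial eigenvalue of the weighted Neumann
problem on the half-sphere of `ℝ^N` is `N + α - 1`; it is the minimum of the Rayleigh quotient and
the sharp constant in the weighted Wirtinger inequality. -/
theorem theorem3p1 (n : ℕ) (hn : 2 ≤ n + 1) (α : ℝ) (hα : α ∈ Set.Ioo (-1 : ℝ) 0) :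
    IsLeast {μ : ℝ | HalfSphere.IsEigenvalue n α μ} (((n + 1 : ℕ) : ℝ) + α - 1) ∧
    IsLeast (HalfSphere.rayleighValues n α) (((n + 1 : ℕ) : ℝ) + α - 1) ∧
    IsGreatest (HalfSphere.wirtingerConstants n α) (((n + 1 : ℕ) : ℝ) + α - 1) := by
  have hfin := isFiniteMeasure_sigma n hα
  have hn1 : 1 ≤ n := by omega
  have hn1' : (1 : ℝ) ≤ n := by exact_mod_cast hn1
  have hpos : 0 < n + α := by linarith [hα.1]
  have hc : ((n + 1 : ℕ) : ℝ) + α - 1 = n + α := by push_cast; ring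
  rw [hc]
  set j : Fin n := ⟨0, hn1⟩
  have hX := polyLp_gradLp_mem_W12 (n := n) (α := α) (MvPolynomial.X j)
  have hX0 := polyLp_X_ne_zero (α := α) j
  have hXi := integral_polyLp_X hpos j
  have hXn : 0 < ‖polyLp n α (MvPolynomial.X j)‖ ^ 2 := by positivity
  refine ⟨⟨⟨_, hX, hX0, hXi, fun φ hφ => ?_⟩, ?_⟩, ⟨⟨_, hX, hX0, hXi, ?_⟩, ?_⟩, ?_, ?_⟩
  · have := inner_gradLp_X j hφ
    rw [L2.inner_def, L2.inner_def] at this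
    simpa [mul_comm] using this
  · rintro μ ⟨u, hu, hu0, hui, hμ⟩
    have h1 := mul_norm_sq_le hn1 hα.1 hu hui
    have h2 := hμ u hu
    simp_rw [real_inner_self_eq_norm_sq, ← pow_two] at h2
    rw [← norm_sq_eq_integral_norm_sq, ← norm_sq_eq_integral_sq] at h2
    rw [h2] at h1
    exact le_of_mul_le_mul_right h1 (by positivity)
  · rw [← norm_sq_eq_integral_norm_sq, ← norm_sq_eq_integral_sq, norm_gradLp_X_sq,
      mul_div_cancel_right₀ _ hXn.ne']
  · rintro r ⟨u, hu, hu0, hui, rfl⟩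
    rw [← norm_sq_eq_integral_norm_sq, ← norm_sq_eq_integral_sq, le_div_iff₀ (by positivity)]
    exact mul_norm_sq_le hn1 hα.1 hu hui
  · intro u hu
    set a := ⨍ η, u.1 η ∂(sigma n α) with ha
    have hsub : ⇑(u.1 - polyLp n α (MvPolynomial.C a)) =ᵐ[sigma n α] fun ζ => u.1 ζ - a := by
      filter_upwards [Lp.coeFn_sub u.1 (polyLp n α (MvPolynomial.C a)),
        coeFn_polyLp_C (n := n) (α := α) a] with ζ h1 h2
      rw [h1, Pi.sub_apply, h2]
    have h0 : inner ℝ (polyLp n α (MvPolynomial.C 1)) (u.1 - polyLp n α (MvPolynomial.C a)) =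
        0 := by
      rw [inner_polyLp_one, integral_congr_ae hsub, ha]
      exact integral_sub_average _ _
    have h1 := mul_norm_sub_sq_le hn1 hα.1 hu h0
    rw [norm_sq_eq_integral_norm_sq, norm_sq_eq_integral_sq] at h1
    rwa [integral_congr_ae (hsub.mono fun ζ hζ => congrArg (· ^ 2) hζ)] at h1
  · intro c hcW
    have h1 := hcW _ hX
    have h2 : ⨍ η, polyLp n α (MvPolynomial.X j) η ∂(sigma n α) = 0 := by
      rw [average_eq, hXi, smul_zero]
    simp only [h2, sub_zero] at h1
    rw [← norm_sq_eq_integral_norm_sq, ← norm_sq_eq_integral_sq, norm_gradLp_X_sq] at h1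
    exact le_of_mul_le_mul_right h1 hXn
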